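/- Rings are associative with unit, not necessarily commutative; modules are right modules; noetherian means left and right noetherian. A ring $R$ with Jacobson radical $J$ is semiperfect if $R/J$ is semisimple and idempotents lift modulo $J$; a semiperfect ring $R$ is basic if $1=e_1+\dots+e_n$ with pairwise orthogonal primitive idempotents $e_i$ such that $e_iR\not\cong e_jR$ as right modules for $i\neq j$. Let $R$ be a basic semiperfect noetherian ring and let $e\in R$ be a primitive idempotent. Put $S_e:=eR/\operatorname{rad}(eR)$, a right $R$-module, and $\Gamma_e:=(1-e)R(1-e)$, a ring with unit $1-e$; then $eR(1-e)$ is a right $\Gamma_e$-module by multiplication in $R$. Assume that $\operatorname{Ext}^1_R(S_e,S_e)=0$. If the projective dimensions $\operatorname{pdim}_R S_e$ and $\operatorname{pdim}_{\Gamma_e} eR(1-e)$ are both finite (the zero module being regarded as having finite projective dimension), then $S_e$ is self-orthogonal, that is, $\operatorname{Ext}^k_R(S_e,S_e)=0$ for all $k\geq 1$. -/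

import Mathlib

open CategoryTheory

universe u

/-- A ring is semiperfect if it is semisimple modulo its Jacobson radical and idempotents lift
modulo the Jacobson radical. -/
def IsSemiperfectRing (R : Type u) [Ring R] : Prop :=
  IsSemisimpleRing (R ⧸ Ring.jacobson R) ∧
    ∀ x : R ⧸ Ring.jacobson R, IsIdempotentElem x →
      ∃ f : R, IsIdempotentElem f ∧ Ideal.Quotient.mk (Ring.jacobson R) f = x

/-- A primitive idempotent: a nonzero idempotent which is not the sum of two nonzero orthogonal
idempotents. -/
structure IsPrimitiveIdempotent {R : Type u} [Ring R] (e : R) : Prop where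
  idem : IsIdempotentElem e
  ne_zero : e ≠ 0
  indecomposable : ∀ f g : R, IsIdempotentElem f → IsIdempotentElem g →
    f * g = 0 → g * f = 0 → f + g = e → f = 0 ∨ g = 0

/-- The right ideal `eR`, as a right `R`-module. Right `R`-modules are modules over `Rᵐᵒᵖ`. -/
abbrev rightIdealOf {R : Type u} [Ring R] (e : R) : Submodule Rᵐᵒᵖ R :=
  Submodule.span Rᵐᵒᵖ {e}

/-- A (semiperfect) ring is basic if `1` is a sum of pairwise orthogonal primitive idempotents
`e₁, …, eₙ` such that the right modules `eᵢR` are pairwise non-isomorphic. -/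
def IsBasicRing (R : Type u) [Ring R] : Prop :=
  ∃ (n : ℕ) (e : Fin n → R), CompleteOrthogonalIdempotents e ∧
    (∀ i, IsPrimitiveIdempotent (e i)) ∧
    ∀ i j, i ≠ j → IsEmpty (rightIdealOf (e i) ≃ₗ[Rᵐᵒᵖ] rightIdealOf (e j))

/-- The right `R`-module `S_e = eR / rad(eR)`, where the radical of a module is the intersection of
its maximal submodules. -/
abbrev topOf {R : Type u} [Ring R] (e : R) : ModuleCat.{u} Rᵐᵒᵖ :=
  ModuleCat.of Rᵐᵒᵖ (rightIdealOf e ⧸ Module.jacobson Rᵐᵒᵖ (rightIdealOf e))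

/-- The additive group `eRf`. -/
def peirceCorner {R : Type u} [Ring R] (e f : R) : AddSubgroup R where
  carrier := {x | ∃ r : R, e * r * f = x}
  add_mem' := by
    rintro _ _ ⟨a, rfl⟩ ⟨b, rfl⟩
    exact ⟨a + b, by rw [mul_add, add_mul]⟩
  zero_mem' := ⟨0, by simp⟩
  neg_mem' := by
    rintro _ ⟨a, rfl⟩
    exact ⟨-a, by simp⟩

/-- For an idempotent `f`, the group `eRf` is a right module over the ring `fRf` (with unit `f`),
by multiplication in `R`. -/
instance peirceModule {R : Type u} [Ring R] (e : R) {f : R} (hf : IsIdempotentElem f) :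
    Module (hf.Corner)ᵐᵒᵖ (peirceCorner e f) where
  smul c x := ⟨x.1 * c.unop.1, by
    obtain ⟨x, a, rfl⟩ := x
    obtain ⟨⟨c, hc⟩⟩ := c
    have h := ((Subsemigroup.mem_corner_iff hf).mp hc).2
    refine ⟨a * f * c, ?_⟩
    change e * (a * f * c) * f = e * a * f * c
    rw [mul_assoc e, mul_assoc (a * f), h]
    simp only [mul_assoc]⟩
  one_smul x := Subtype.ext <| by
    obtain ⟨x, a, rfl⟩ := x
    change e * a * f * f = e * a * f
    rw [mul_assoc, hf.eq]
  mul_smul c d x := Subtype.ext (mul_assoc x.1 d.unop.1 c.unop.1).symm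
  smul_zero c := Subtype.ext (zero_mul c.unop.1)
  smul_add c x y := Subtype.ext (add_mul x.1 y.1 c.unop.1)
  add_smul c d x := Subtype.ext (mul_add x.1 c.unop.1 d.unop.1)
  zero_smul x := Subtype.ext (mul_zero x.1)

/-- An object `M` is self-orthogonal if `Ext^k(M, M) = 0` for all `k ≥ 1`. -/
def IsSelfOrthogonal {S : Type u} [Ring S] (M : ModuleCat.{u} S) : Prop :=
  ∀ k : ℕ, 1 ≤ k → Subsingleton (Abelian.Ext M M k)

/-! Put `A = Rᵐᵒᵖ`, `φ = 1 - e`, `Γ = φRφ` (opposite) and `S = S_e`. As `R` is basic, `φ` kills `S`;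
as `Ext¹(S, S) = 0`, `eJ` is generated by `eR(1 - e)`, so `S` embeds into every nonzero module
killed by `φ` (`exists_injective_of_topOf`).

Since `pdim S` is finite, failure of self-orthogonality gives a largest `m ≥ 1` with `Ext^m(S, S) ≠
0`. The core, `ExtVanish.of_projectiveDimension_cornerPart`, says: if `N` is finitely generated,
`φN` has finite projective dimension over `Γ` and `Ext^k(N, S) = 0` for `k ≥ m`, then `Ext^k(N, S) =
0` for all `k`, including `Hom`. For the projective module `N = eR` this contradicts the nonzero
projection `eR → S`.

The core is an induction on the dimension of `φN`. Let `I` be the submodule generated by `φN`, and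
`K` the kernel of a cover of `I` by `Q`, a finite power of `Aφ`. All `Ext^k(Q, S)` vanish, so `K`
inherits the vanishing in degrees `≥ m`, and `φK` is a syzygy of `φN`. Vanishing for `K` in all
degrees passes to `I`, hence `Ext^m(N/I, S) = 0`. Were `N/I ≠ 0`, an embedding of `S` would make
`Ext^m(S, S)` vanish; so `N = I`. When `φN` is projective, `φK` generates a direct summand of `Q`,
which starts the induction. -/

/-! ### Vanishing of Ext along short exact sequences. -/

section ExtVanish

variable (A : Type u) [Ring A] (S : Type u) [AddCommGroup S] [Module A S]

/-- The vanishing of `Ext^k(N, S)` for modules `N` and `S`. -/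
def ExtVanish (N : Type u) [AddCommGroup N] [Module A N] (k : ℕ) : Prop :=
  Subsingleton (Abelian.Ext (ModuleCat.of A N) (ModuleCat.of A S) k)

variable {A}
variable {M₁ M₂ M₃ : Type u} [AddCommGroup M₁] [AddCommGroup M₂] [AddCommGroup M₃]
  [Module A M₁] [Module A M₂] [Module A M₃]

theorem exists_shortExact_of_exact {f : M₁ →ₗ[A] M₂} {g : M₂ →ₗ[A] M₃}
    (hf : Function.Injective f) (hfg : Function.Exact f g) (hg : Function.Surjective g) :
    ∃ w, (ShortComplex.mk (ModuleCat.ofHom f) (ModuleCat.ofHom g) w).ShortExact :=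
  ⟨by ext x; exact hfg.apply_apply_eq_zero x, ModuleCat.shortComplex_shortExact _ hfg hf hg⟩

variable {S}

theorem ExtVanish.middle {f : M₁ →ₗ[A] M₂} {g : M₂ →ₗ[A] M₃}
    (hf : Function.Injective f) (hfg : Function.Exact f g) (hg : Function.Surjective g) {k : ℕ}
    (h₁ : ExtVanish A S M₁ k) (h₃ : ExtVanish A S M₃ k) : ExtVanish A S M₂ k := by
  obtain ⟨w, hs⟩ := exists_shortExact_of_exact hf hfg hg
  refine subsingleton_of_forall_eq 0 fun x => ?_
  obtain ⟨y, rfl⟩ := Abelian.Ext.contravariant_sequence_exact₂ hs _ x (h₁.elim _ _)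
  rw [h₃.elim y 0, Abelian.Ext.comp_zero]

theorem ExtVanish.left {f : M₁ →ₗ[A] M₂} {g : M₂ →ₗ[A] M₃}
    (hf : Function.Injective f) (hfg : Function.Exact f g) (hg : Function.Surjective g) {k : ℕ}
    (h₂ : ExtVanish A S M₂ k) (h₃ : ExtVanish A S M₃ (k + 1)) : ExtVanish A S M₁ k := by
  obtain ⟨w, hs⟩ := exists_shortExact_of_exact hf hfg hg
  refine subsingleton_of_forall_eq 0 fun x => ?_
  obtain ⟨y, rfl⟩ := Abelian.Ext.contravariant_sequence_exact₁ hs _ x (add_comm 1 k) (h₃.elim _ _)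
  rw [h₂.elim y 0, Abelian.Ext.comp_zero]

theorem ExtVanish.right {f : M₁ →ₗ[A] M₂} {g : M₂ →ₗ[A] M₃}
    (hf : Function.Injective f) (hfg : Function.Exact f g) (hg : Function.Surjective g) {k : ℕ}
    (h₁ : ExtVanish A S M₁ k) (h₂ : ExtVanish A S M₂ (k + 1)) : ExtVanish A S M₃ (k + 1) := by
  obtain ⟨w, hs⟩ := exists_shortExact_of_exact hf hfg hg
  refine subsingleton_of_forall_eq 0 fun x => ?_
  obtain ⟨y, rfl⟩ := Abelian.Ext.contravariant_sequence_exact₃ hs _ x (h₂.elim _ _) (add_comm 1 k)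
  rw [h₁.elim y 0, Abelian.Ext.comp_zero]

theorem extVanish_zero_iff {N : Type u} [AddCommGroup N] [Module A N] :
    ExtVanish A S N 0 ↔ ∀ g : N →ₗ[A] S, g = 0 := by
  constructor
  · intro h g
    have := (Abelian.Ext.homEquiv₀ (X := ModuleCat.of A N) (Y := ModuleCat.of A S)).symm.injective
      (h.elim (Abelian.Ext.homEquiv₀.symm (ModuleCat.ofHom g))
      (Abelian.Ext.homEquiv₀.symm (ModuleCat.ofHom 0)))
    exact congrArg ModuleCat.Hom.hom this
  · intro h
    refine (Abelian.Ext.homEquiv₀ (X := ModuleCat.of A N)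
      (Y := ModuleCat.of A S)).subsingleton_congr.mpr ⟨fun a b => ?_⟩
    ext1
    rw [h a.hom, h b.hom]

theorem ExtVanish.right_zero {g : M₂ →ₗ[A] M₃} (hg : Function.Surjective g)
    (h₂ : ExtVanish A S M₂ 0) : ExtVanish A S M₃ 0 := by
  rw [extVanish_zero_iff] at h₂ ⊢
  intro f
  ext x
  obtain ⟨y, rfl⟩ := hg x
  exact LinearMap.congr_fun (h₂ (f ∘ₗ g)) y

theorem ExtVanish.retract {i : M₁ →ₗ[A] M₂} {p : M₂ →ₗ[A] M₁} (h : ∀ x, p (i x) = x) {k : ℕ}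
    (h₂ : ExtVanish A S M₂ k) : ExtVanish A S M₁ k := by
  refine subsingleton_of_forall_eq 0 fun x => ?_
  have hid : ModuleCat.ofHom i ≫ ModuleCat.ofHom p = 𝟙 (ModuleCat.of A M₁) := by
    ext y; exact h y
  have h0 : (Abelian.Ext.mk₀ (ModuleCat.ofHom p)).comp x (zero_add k) = 0 := h₂.elim _ _
  have h1 := congrArg (fun z => (Abelian.Ext.mk₀ (ModuleCat.ofHom i)).comp z (zero_add k)) h0
  simpa [hid] using h1

theorem ExtVanish.exists_extension {f : M₁ →ₗ[A] M₂} {g : M₂ →ₗ[A] M₃}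
    (hf : Function.Injective f) (hfg : Function.Exact f g) (hg : Function.Surjective g)
    (h₃ : ExtVanish A S M₃ 1) (l : M₁ →ₗ[A] S) : ∃ l' : M₂ →ₗ[A] S, l' ∘ₗ f = l := by
  obtain ⟨w, hs⟩ := exists_shortExact_of_exact hf hfg hg
  obtain ⟨y, hy⟩ := Abelian.Ext.contravariant_sequence_exact₁ hs (ModuleCat.of A S)
    (Abelian.Ext.mk₀ (ModuleCat.ofHom l)) (add_comm 1 0) (h₃.elim _ _)
  obtain ⟨l', rfl⟩ := Abelian.Ext.homEquiv₀.symm.surjective y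
  rw [Abelian.Ext.homEquiv₀_symm_apply, Abelian.Ext.mk₀_comp_mk₀] at hy
  exact ⟨l'.hom, congrArg ModuleCat.Hom.hom (Abelian.Ext.homEquiv₀.symm.injective hy)⟩

theorem ExtVanish.of_subsingleton [Subsingleton M₁] (k : ℕ) : ExtVanish A S M₁ k := by
  refine subsingleton_of_forall_eq 0 fun x => ?_
  have : HasProjectiveDimensionLT (ModuleCat.of A M₁) 0 :=
    (ModuleCat.isZero_of_subsingleton _).hasProjectiveDimensionLT_zero
  exact x.eq_zero_of_hasProjectiveDimensionLT 0 (Nat.zero_le _)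

theorem ExtVanish.of_projective [Module.Projective A M₁] (k : ℕ) : ExtVanish A S M₁ (k + 1) := by
  have : Projective (ModuleCat.of A M₁) := (IsProjective.iff_projective M₁).mp inferInstance
  exact HasProjectiveDimensionLT.subsingleton _ 1 (k + 1) (by lia) _

end ExtVanish

/-! ### The functor `N ↦ φN` and covers by powers of `Aφ`. -/

section CornerPart

variable {A Γ : Type u} [Ring A] [Ring Γ] (ψ : Γ →ₙ+* A)

/-- For an idempotent `φ = ψ 1` of `A`, the `φAφ`-module `φN`, with scalars restricted along `ψ`. -/
def cornerPart (N : Type u) [AddCommGroup N] [Module A N] : AddSubgroup N where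
  carrier := {x | ψ 1 • x = x}
  add_mem' {a b} ha hb := by
    change ψ 1 • (a + b) = a + b
    rw [smul_add, ha, hb]
  zero_mem' := smul_zero _
  neg_mem' {a} ha := by
    change ψ 1 • (-a) = -a
    rw [smul_neg, ha]

variable {N N' : Type u} [AddCommGroup N] [Module A N] [AddCommGroup N'] [Module A N']

theorem smul_mem_cornerPart (γ : Γ) (x : N) : ψ γ • x ∈ cornerPart ψ N := by
  change ψ 1 • ψ γ • x = ψ γ • x
  rw [smul_smul, ← map_mul, one_mul]

instance : Module Γ (cornerPart ψ N) where
  smul γ x := ⟨ψ γ • x.1, smul_mem_cornerPart ψ γ x.1⟩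
  one_smul x := Subtype.ext x.2
  mul_smul c d x := Subtype.ext <| by
    change ψ (c * d) • x.1 = ψ c • ψ d • x.1
    rw [map_mul, mul_smul]
  smul_zero c := Subtype.ext (smul_zero _)
  smul_add c x y := Subtype.ext (smul_add _ _ _)
  add_smul c d x := Subtype.ext <| by
    change ψ (c + d) • x.1 = ψ c • x.1 + ψ d • x.1
    rw [map_add, add_smul]
  zero_smul x := Subtype.ext <| by
    change ψ 0 • x.1 = 0
    rw [map_zero, zero_smul]

theorem cornerPart_coe_smul (γ : Γ) (x : cornerPart ψ N) :
    ((γ • x : cornerPart ψ N) : N) = ψ γ • (x : N) := rfl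

/-- The map `φN → φN'` induced by an `A`-linear map `N → N'`. -/
def cornerMap (g : N →ₗ[A] N') : cornerPart ψ N →ₗ[Γ] cornerPart ψ N' where
  toFun x := ⟨g x.1, by
    change ψ 1 • g x.1 = g x.1
    rw [← map_smul, show ψ 1 • x.1 = x.1 from x.2]⟩
  map_add' x y := Subtype.ext (map_add g _ _)
  map_smul' c x := Subtype.ext (map_smul g (ψ c) x.1)

theorem cornerMap_coe (g : N →ₗ[A] N') (x : cornerPart ψ N) : (cornerMap ψ g x : N') = g x := rfl

/-- The submodule of `N` generated by `φN`. -/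
def cornerSpan (N : Type u) [AddCommGroup N] [Module A N] : Submodule A N :=
  Submodule.span A (cornerPart ψ N : Set N)

theorem mem_cornerSpan {x : N} (hx : x ∈ cornerPart ψ N) : x ∈ cornerSpan ψ N :=
  Submodule.subset_span hx

theorem cornerSpan_le {L : Submodule A N} (h : ∀ x ∈ cornerPart ψ N, x ∈ L) :
    cornerSpan ψ N ≤ L :=
  Submodule.span_le.mpr h

theorem map_one_mul_map_one : ψ 1 * ψ 1 = ψ 1 := by rw [← map_mul, one_mul]

/-- The left ideal `Aφ`, where `φ = ψ 1`. -/
abbrev cornerIdeal : Submodule A A := Submodule.span A {ψ 1}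

/-- The generator `φ` of `Aφ`. -/
def cornerGen : cornerIdeal ψ := ⟨ψ 1, Submodule.mem_span_singleton_self _⟩

theorem cornerGen_mem : cornerGen ψ ∈ cornerPart ψ (cornerIdeal ψ) :=
  Subtype.ext (map_one_mul_map_one ψ)

theorem coe_smul_cornerGen (b : cornerIdeal ψ) : (b : A) • cornerGen ψ = b := by
  obtain ⟨b, hb⟩ := b
  obtain ⟨a, rfl⟩ := Submodule.mem_span_singleton.mp hb
  refine Subtype.ext ?_
  change a * ψ 1 * ψ 1 = a * ψ 1
  rw [mul_assoc, map_one_mul_map_one]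

instance : Module.Projective A (cornerIdeal ψ) :=
  Module.Projective.of_split (cornerIdeal ψ).subtype (LinearMap.toSpanSingleton A _ (cornerGen ψ))
    (by ext1 b; exact coe_smul_cornerGen ψ b)

/-- The generators are fixed by `φ`, so their images lie in `φN = 0`. -/
theorem linearMap_finsupp_cornerIdeal_eq_zero {ι : Type u} (hN : ∀ x : N, ψ 1 • x = 0)
    (g : (ι →₀ cornerIdeal ψ) →ₗ[A] N) : g = 0 := by
  ext i b : 2
  change g (Finsupp.single i b) = 0
  rw [← coe_smul_cornerGen ψ b, ← show ψ 1 • cornerGen ψ = _ from cornerGen_mem ψ,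
    ← Finsupp.smul_single, ← Finsupp.smul_single, map_smul, map_smul, hN, smul_zero]

variable {ψ}

variable (ψ) in
/-- The comparison map from the free `φAφ`-module on `ι` to `φ(Aφ)^(ι)`. -/
noncomputable def finsuppToCorner (ι : Type u) :
    (ι →₀ Γ) →ₗ[Γ] cornerPart ψ (ι →₀ cornerIdeal ψ) where
  toFun c := ⟨c.mapRange (fun γ => ψ γ • cornerGen ψ) (by simp), by
    change ψ 1 • _ = _
    ext i : 1
    simp only [Finsupp.smul_apply, Finsupp.mapRange_apply, smul_smul, ← map_mul, one_mul]⟩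
  map_add' x y := by
    refine Subtype.ext (Finsupp.ext fun i => ?_)
    simp [add_smul]
  map_smul' c x := by
    refine Subtype.ext (Finsupp.ext fun i => ?_)
    simp [cornerPart_coe_smul, mul_smul]

theorem finsuppToCorner_single {ι : Type u} (i : ι) (γ : Γ) :
    (finsuppToCorner ψ ι (Finsupp.single i γ) : ι →₀ cornerIdeal ψ) =
      ψ γ • Finsupp.single i (cornerGen ψ) := by
  change Finsupp.mapRange _ (by simp) (Finsupp.single i γ) = _
  rw [Finsupp.mapRange_single, Finsupp.smul_single]

theorem finsuppToCorner_bijective (hinj : Function.Injective ψ)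
    (hsurj : ∀ a, ∃ γ, ψ γ = ψ 1 * a * ψ 1) (ι : Type u) :
    Function.Bijective (finsuppToCorner ψ ι) := by
  constructor
  · intro x y hxy
    ext i
    have h := congrArg Subtype.val (DFunLike.congr_fun (congrArg Subtype.val hxy) i)
    refine hinj ?_
    change ψ (x i) * ψ 1 = ψ (y i) * ψ 1 at h
    simpa only [← map_mul, mul_one] using h
  · intro x
    choose δ hδ using hsurj
    have h0 : δ 0 = 0 := hinj (by simp [hδ])
    refine ⟨x.1.mapRange (fun b => δ b.1) h0, Subtype.ext (Finsupp.ext fun i => ?_)⟩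
    have hx : ψ 1 • x.1 i = x.1 i := DFunLike.congr_fun (show ψ 1 • x.1 = x.1 from x.2) i
    change ψ (δ (x.1 i).1) • cornerGen ψ = x.1 i
    have h2 := coe_smul_cornerGen ψ (x.1 i)
    rw [hδ, mul_smul, mul_smul, show ψ 1 • cornerGen ψ = _ from cornerGen_mem ψ, h2, hx]

theorem projective_cornerPart_finsupp (hinj : Function.Injective ψ)
    (hsurj : ∀ a, ∃ γ, ψ γ = ψ 1 * a * ψ 1) (ι : Type u) :
    Module.Projective Γ (cornerPart ψ (ι →₀ cornerIdeal ψ)) :=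
  Module.Projective.of_equiv (LinearEquiv.ofBijective _ (finsuppToCorner_bijective hinj hsurj ι))

variable (ψ)

/-- The `A`-linear map `(Aφ)^(ι) → N` which sends the generators to given elements. -/
noncomputable def cornerCover {ι : Type u} (t : ι → N) : (ι →₀ cornerIdeal ψ) →ₗ[A] N :=
  Finsupp.lsum ℕ fun i => LinearMap.toSpanSingleton A N (t i) ∘ₗ (cornerIdeal ψ).subtype

theorem cornerCover_single {ι : Type u} (t : ι → N) (i : ι) (b : cornerIdeal ψ) :
    cornerCover ψ t (Finsupp.single i b) = (b : A) • t i := by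
  simp [cornerCover]

theorem cornerCover_single_gen {ι : Type u} (t : ι → N) (i : ι) (h : t i ∈ cornerPart ψ N) :
    cornerCover ψ t (Finsupp.single i (cornerGen ψ)) = t i := by
  rw [cornerCover_single]
  exact h

end CornerPart

/-! ### Induction on the projective dimension of `φN`. -/

section Main

variable {A Γ : Type u} [Ring A] [Ring Γ] {ψ : Γ →ₙ+* A}
variable {S : Type u} [AddCommGroup S] [Module A S]
variable {N : Type u} [AddCommGroup N] [Module A N]

theorem extVanish_finsupp_cornerIdeal (hS : ∀ s : S, ψ 1 • s = 0) (ι : Type u) :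
    ∀ k, ExtVanish A S (ι →₀ cornerIdeal ψ) k
  | 0 => extVanish_zero_iff.mpr fun g => linearMap_finsupp_cornerIdeal_eq_zero ψ hS g
  | k + 1 =>
    have := Classical.decEq ι
    have := Classical.decEq (cornerIdeal ψ)
    have := Module.Projective.of_equiv
      (finsuppLequivDFinsupp A : (ι →₀ cornerIdeal ψ) ≃ₗ[A] _).symm
    ExtVanish.of_projective k

/-- If `φN` is projective and `K` is the kernel of a cover `Q → N`, then `φK` generates a direct
summand of `Q`. -/
theorem extVanish_cornerSpan_of_projective (hinj : Function.Injective ψ)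
    (hsurj : ∀ a, ∃ γ, ψ γ = ψ 1 * a * ψ 1) (hS0 : ∀ s : S, ψ 1 • s = 0)
    [Module.Projective Γ (cornerPart ψ N)] {ι : Type u} (π : (ι →₀ cornerIdeal ψ) →ₗ[A] N)
    (hπ : Function.Surjective (cornerMap ψ π)) {K : Type u} [AddCommGroup K] [Module A K]
    (j : K →ₗ[A] (ι →₀ cornerIdeal ψ)) (hj : Function.Injective j) (hjπ : Function.Exact j π)
    (k : ℕ) : ExtVanish A S (cornerSpan ψ K) k := by
  set L := cornerSpan ψ K
  obtain ⟨s, hs⟩ := Module.projective_lifting_property (cornerMap ψ π) LinearMap.id hπ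
  have hs' : ∀ y, cornerMap ψ π (s y) = y := LinearMap.congr_fun hs
  -- Since `s` splits `φQ → φN`, `r` is a projection of `φQ` onto the image of `φK`.
  let r : cornerPart ψ (ι →₀ cornerIdeal ψ) →ₗ[Γ] cornerPart ψ (ι →₀ cornerIdeal ψ) :=
    LinearMap.id - s ∘ₗ cornerMap ψ π
  have hr : ∀ q, ∃ y : K, j y = (r q).1 := fun q => by
    have : cornerMap ψ π (r q) = 0 := by simp [r, hs']
    exact (hjπ _).mp (congrArg Subtype.val this)
  choose κ hκ using hr
  have hκm : ∀ q, κ q ∈ cornerPart ψ K := fun q => hj <| by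
    rw [map_smul, hκ]
    exact (r q).2
  let gen : ι → cornerPart ψ (ι →₀ cornerIdeal ψ) := fun i =>
    finsuppToCorner ψ ι (Finsupp.single i 1)
  have hκL : ∀ q, (⟨κ q, mem_cornerSpan ψ (hκm q)⟩ : L) ∈ cornerPart ψ L := fun q =>
    Subtype.ext (hκm q)
  let ρ : (ι →₀ cornerIdeal ψ) →ₗ[A] L := cornerCover ψ fun i =>
    (⟨κ (gen i), mem_cornerSpan ψ (hκm _)⟩ : L)
  -- `ρ` extends `r` to `Q`: both are `Γ`-linear on `φQ`, which is free on the generators where they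
  -- agree by construction.
  have hρ : ∀ q : cornerPart ψ (ι →₀ cornerIdeal ψ), j (ρ q.1).1 = (r q).1 := by
    have key : cornerMap ψ (j ∘ₗ L.subtype ∘ₗ ρ) ∘ₗ finsuppToCorner ψ ι =
        r ∘ₗ finsuppToCorner ψ ι := by
      refine Finsupp.lhom_ext fun i γ => ?_
      rw [← mul_one γ, ← smul_eq_mul, ← Finsupp.smul_single, map_smul, map_smul]
      congr 1
      refine Subtype.ext ?_
      change j (ρ (finsuppToCorner ψ ι (Finsupp.single i 1)).1).1 = (r (gen i)).1
      rw [finsuppToCorner_single, map_smul, cornerCover_single_gen ψ _ _ (hκL _)]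
      change j (ψ 1 • κ (gen i)) = _
      rw [show ψ 1 • κ (gen i) = _ from hκm _, hκ]
    intro q
    obtain ⟨c, rfl⟩ := (finsuppToCorner_bijective hinj hsurj ι).2 q
    exact congrArg Subtype.val (LinearMap.congr_fun key c)
  -- `ρ ∘ j` is the identity on `L`; it suffices to check this on `φK`, where `π ∘ j = 0` makes `r`
  -- the identity.
  have hle : L ≤ LinearMap.eqLocus (L.subtype ∘ₗ ρ ∘ₗ j) LinearMap.id := by
    refine cornerSpan_le ψ fun x hx => hj ?_
    have h1 := hρ (cornerMap ψ j ⟨x, hx⟩)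
    have h2 : cornerMap ψ π (cornerMap ψ j ⟨x, hx⟩) = 0 := Subtype.ext (hjπ.apply_apply_eq_zero x)
    refine h1.trans ?_
    simp [r, h2, cornerMap_coe]
  exact ExtVanish.retract (i := j ∘ₗ L.subtype) (p := ρ)
    (fun x => Subtype.ext (hle x.2)) (extVanish_finsupp_cornerIdeal hS0 ι k)

variable (ψ) in
/-- `S` embeds into every nonzero module killed by `φ = ψ 1`. -/
def EmbedsInKilled (S : Type u) [AddCommGroup S] [Module A S] : Prop :=
  ∀ (W : Type u) [AddCommGroup W] [Module A W], Nontrivial W → (∀ w : W, ψ 1 • w = 0) →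
    ∃ g : S →ₗ[A] W, Function.Injective g

variable [Nontrivial S]

theorem ExtVanish.of_killed (hS : EmbedsInKilled ψ S) {k : ℕ} (hk : ExtVanish A S S k)
    [IsNoetherian A N] (hN : ∀ x : N, ψ 1 • x = 0) : ExtVanish A S N k := by
  -- Noetherian induction needs the claim for all quotients `W` of `N`, indexed by their kernels;
  -- splitting off a copy of `S` enlarges the kernel.
  suffices H : ∀ (L : Submodule A N) (W : Type u) [AddCommGroup W] [Module A W]
      (q : N →ₗ[A] W), Function.Surjective q → LinearMap.ker q = L → ExtVanish A S W k from
    H ⊥ N LinearMap.id Function.surjective_id (LinearMap.ker_id)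
  intro L
  induction L using IsNoetherian.induction with
  | hgt L ih =>
    intro W _ _ q hq hL
    rcases subsingleton_or_nontrivial W with hW | hW
    · exact ExtVanish.of_subsingleton k
    · have hW0 : ∀ w : W, ψ 1 • w = 0 := fun w => by
        obtain ⟨x, rfl⟩ := hq w
        rw [← map_smul, hN, map_zero]
      obtain ⟨g, hg⟩ := hS W hW hW0
      refine ExtVanish.middle hg (LinearMap.exact_map_mkQ_range g)
        (Submodule.mkQ_surjective _) hk
        (ih (LinearMap.ker ((LinearMap.range g).mkQ ∘ₗ q)) ?_ _ _
          ((Submodule.mkQ_surjective _).comp hq) rfl)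
      rw [← hL]
      obtain ⟨v, hv, hv0⟩ : ∃ v ∈ LinearMap.range g, v ≠ 0 := by
        obtain ⟨s, hs⟩ := exists_ne (0 : S)
        exact ⟨g s, ⟨s, rfl⟩, (map_ne_zero_iff g hg).mpr hs⟩
      obtain ⟨x, rfl⟩ := hq v
      refine lt_of_le_not_ge (LinearMap.ker_le_ker_comp _ _) fun hle => hv0 ?_
      exact hle ((Submodule.Quotient.mk_eq_zero _).mpr hv)

variable {n : ℕ}

/-- If `Ext^k(N, S) = 0` for `k ≥ n`, and for all `k` on the submodule generated by `φN`, then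
it vanishes for all `k`. -/
theorem ExtVanish.of_cornerSpan (hS : EmbedsInKilled ψ S) (hSn : ¬ ExtVanish A S S (n + 1))
    (hSk : ∀ k, n + 1 < k → ExtVanish A S S k) [IsNoetherian A N]
    (hI : ∀ k, ExtVanish A S (cornerSpan ψ N) k)
    (hN : ∀ k, n + 1 ≤ k → ExtVanish A S N k) (k : ℕ) : ExtVanish A S N k := by
  set I := cornerSpan ψ N
  have hW : ∀ w : N ⧸ I, ψ 1 • w = 0 := fun w => by
    obtain ⟨x, rfl⟩ := I.mkQ_surjective w
    rw [← map_smul]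
    exact (Submodule.Quotient.mk_eq_zero I).mpr
      (mem_cornerSpan ψ (smul_mem_cornerPart ψ 1 x))
  have hex : Function.Exact I.subtype I.mkQ := LinearMap.exact_subtype_mkQ I
  have hWn : ExtVanish A S (N ⧸ I) (n + 1) :=
    ExtVanish.right I.subtype_injective hex I.mkQ_surjective (hI n) (hN _ le_rfl)
  rcases subsingleton_or_nontrivial (N ⧸ I) with h | h
  · exact ExtVanish.middle I.subtype_injective hex I.mkQ_surjective (hI k)
      (ExtVanish.of_subsingleton k)
  -- If `N/I ≠ 0`, then `Ext^(n+1)(S, S)` lies between `Ext^(n+1)(N/I, S) = 0` and `Ext^(n+2)` of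
  -- the cokernel of `S → N/I`, which is killed by `φ`.
  · obtain ⟨g, hg⟩ := hS _ h hW
    refine absurd (ExtVanish.left hg (LinearMap.exact_map_mkQ_range g)
      (Submodule.mkQ_surjective _) hWn ?_) hSn
    refine ExtVanish.of_killed hS (hSk _ (by lia)) fun x => ?_
    obtain ⟨w, rfl⟩ := (LinearMap.range g).mkQ_surjective x
    rw [← map_smul, hW, map_zero]

/-- If `Ext^k(N, S) = 0` for `k ≥ n`, then so it is for the submodule generated by `φN`. -/
theorem extVanish_cornerSpan (hS : EmbedsInKilled ψ S)
    (hSk : ∀ k, n + 1 < k → ExtVanish A S S k) [IsNoetherian A N]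
    (hN : ∀ k, n + 1 ≤ k → ExtVanish A S N k) (k : ℕ) (hk : n + 1 ≤ k) :
    ExtVanish A S (cornerSpan ψ N) k := by
  set I := cornerSpan ψ N
  refine ExtVanish.left I.subtype_injective (LinearMap.exact_subtype_mkQ I) I.mkQ_surjective
    (hN k hk) (ExtVanish.of_killed hS (hSk _ (by lia)) fun w => ?_)
  obtain ⟨x, rfl⟩ := I.mkQ_surjective w
  rw [← map_smul]
  exact (Submodule.Quotient.mk_eq_zero I).mpr (mem_cornerSpan ψ (smul_mem_cornerPart ψ 1 x))

/-- Generators of the span can be chosen in `φN`, and if `q` maps to `x ∈ φN`, so does `φq`.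
Finiteness of `ι` keeps the kernel finitely generated. -/
theorem exists_cornerCover [IsNoetherian A N] : ∃ (ι : Type u) (_ : Finite ι)
    (π : (ι →₀ cornerIdeal ψ) →ₗ[A] N),
    LinearMap.range π = cornerSpan ψ N ∧
      Function.Surjective (cornerMap ψ π) := by
  obtain ⟨t, ht, hspan⟩ := (Submodule.fg_span_iff_fg_span_finset_subset _).mp
    (IsNoetherian.noetherian (cornerSpan ψ N))
  have hr : LinearMap.range (cornerCover ψ ((↑) : t → N)) =
      cornerSpan ψ N := by
    rw [cornerSpan, hspan]
    apply le_antisymm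
    · rintro _ ⟨q, rfl⟩
      induction q using Finsupp.induction_linear with
      | zero => simp
      | add x y hx hy => rw [map_add]; exact add_mem hx hy
      | single i b =>
        rw [cornerCover_single]
        exact Submodule.smul_mem _ _ (Submodule.subset_span i.2)
    · rw [Submodule.span_le]
      intro x hx
      exact ⟨Finsupp.single ⟨x, hx⟩ (cornerGen ψ), cornerCover_single_gen ψ _ _ (ht hx)⟩
  refine ⟨t, inferInstance, cornerCover ψ (↑), hr, fun x => ?_⟩
  obtain ⟨q, hq⟩ : x.1 ∈ LinearMap.range (cornerCover ψ ((↑) : t → N)) :=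
    hr ▸ mem_cornerSpan ψ x.2
  refine ⟨⟨ψ 1 • q, smul_mem_cornerPart ψ 1 q⟩, Subtype.ext ?_⟩
  rw [cornerMap_coe, map_smul, hq]
  exact x.2

theorem cornerMap_ker_subtype_injective {Q : Type u} [AddCommGroup Q] [Module A Q]
    (π : Q →ₗ[A] N) : Function.Injective (cornerMap ψ (LinearMap.ker π).subtype) :=
  fun _ _ h => Subtype.ext (Subtype.ext (congrArg (fun x => x.1) h))

theorem exact_cornerMap_ker_subtype {Q : Type u} [AddCommGroup Q] [Module A Q]
    (π : Q →ₗ[A] N) :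
    Function.Exact (cornerMap ψ (LinearMap.ker π).subtype) (cornerMap ψ π) := by
  intro x
  constructor
  · intro h
    exact ⟨⟨⟨x.1, congrArg Subtype.val h⟩, Subtype.ext x.2⟩, rfl⟩
  · rintro ⟨y, rfl⟩
    exact Subtype.ext y.1.2

/-- The vanishing of `Ext^k(N, S)` for all `k` reduces to that for the kernel of a cover of the
submodule generated by `φN`. -/
theorem ExtVanish.of_ker (hS0 : ∀ s : S, ψ 1 • s = 0) (hS : EmbedsInKilled ψ S)
    (hSn : ¬ ExtVanish A S S (n + 1)) (hSk : ∀ k, n + 1 < k → ExtVanish A S S k) [IsNoetherian A N]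
    (hN : ∀ k, n + 1 ≤ k → ExtVanish A S N k) {ι : Type u} (π : (ι →₀ cornerIdeal ψ) →ₗ[A] N)
    (hπ : LinearMap.range π = cornerSpan ψ N)
    (hK : (∀ k, n + 1 ≤ k → ExtVanish A S (LinearMap.ker π) k) →
      ∀ k, ExtVanish A S (LinearMap.ker π) k) (k : ℕ) : ExtVanish A S N k := by
  have hQ := extVanish_finsupp_cornerIdeal (ψ := ψ) hS0 ι
  have hinj := (LinearMap.ker π).subtype_injective
  have hex : Function.Exact (LinearMap.ker π).subtype π.rangeRestrict := by
    intro x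
    rw [← LinearMap.mem_ker, LinearMap.ker_rangeRestrict]
    simp
  have hsurj := π.surjective_rangeRestrict
  have hI' := extVanish_cornerSpan hS hSk hN
  rw [← hπ] at hI'
  have hKv := hK fun k hk => ExtVanish.left hinj hex hsurj (hQ k) (hI' (k + 1) (by lia))
  refine ExtVanish.of_cornerSpan hS hSn hSk ?_ hN k
  rw [← hπ]
  rintro (_ | k)
  · exact ExtVanish.right_zero hsurj (hQ 0)
  · exact ExtVanish.right hinj hex hsurj (hKv k) (hQ (k + 1))

/-- Let `n ≥ 1` be the largest degree with `Ext^n(S, S) ≠ 0`. If `φN` has finite projective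
dimension and `Ext^k(N, S) = 0` for `k ≥ n`, then `Ext^k(N, S) = 0` for all `k`. -/
theorem ExtVanish.of_projectiveDimension_cornerPart [IsNoetherianRing A]
    (hinj : Function.Injective ψ) (hsurj : ∀ a, ∃ γ, ψ γ = ψ 1 * a * ψ 1)
    (hS0 : ∀ s : S, ψ 1 • s = 0) (hS : EmbedsInKilled ψ S)
    (hSn : ¬ ExtVanish A S S (n + 1)) (hSk : ∀ k, n + 1 < k → ExtVanish A S S k) (d : ℕ) :
    ∀ (N : Type u) [AddCommGroup N] [Module A N] [Module.Finite A N],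
      HasProjectiveDimensionLT (ModuleCat.of Γ (cornerPart ψ N)) (d + 1) →
      (∀ k, n + 1 ≤ k → ExtVanish A S N k) → ∀ k, ExtVanish A S N k := by
  induction d with
  | zero =>
    intro N _ _ _ hd hN
    obtain ⟨ι, _, π, hπ, hπc⟩ := exists_cornerCover (ψ := ψ) (N := N)
    have : Projective (ModuleCat.of Γ (cornerPart ψ N)) :=
      projective_iff_hasProjectiveDimensionLT_one.mpr hd
    have : Module.Projective Γ (cornerPart ψ N) := (IsProjective.iff_projective _).mpr this
    -- Here the kernel needs no further cover: the submodule generated by `φK` is a summand of `Q`.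
    exact ExtVanish.of_ker hS0 hS hSn hSk hN π hπ fun hK =>
      ExtVanish.of_cornerSpan hS hSn hSk
        (extVanish_cornerSpan_of_projective hinj hsurj hS0 π hπc (K := LinearMap.ker π)
          (LinearMap.ker π).subtype (LinearMap.ker π).subtype_injective
          (LinearMap.exact_subtype_ker_map π)) hK
  | succ d ih =>
    intro N _ _ _ hd hN
    obtain ⟨ι, _, π, hπ, hπc⟩ := exists_cornerCover (ψ := ψ) (N := N)
    refine ExtVanish.of_ker hS0 hS hSn hSk hN π hπ (ih _ ?_)
    obtain ⟨w, hs⟩ := exists_shortExact_of_exact (cornerMap_ker_subtype_injective (ψ := ψ) π)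
      (exact_cornerMap_ker_subtype π) hπc
    have := projective_cornerPart_finsupp hinj hsurj ι
    have : Projective (ModuleCat.of Γ (cornerPart ψ (ι →₀ cornerIdeal ψ))) :=
      (IsProjective.iff_projective _).mp this
    exact hs.hasProjectiveDimensionLT_X₁ (d + 1) (hasProjectiveDimensionLT_of_ge _ 1 _ (by lia)) hd

end Main

/-! ### Idempotents of semiperfect and basic rings modulo the radical. -/

section Semiperfect

variable {R : Type u} [Ring R]

theorem isUnit_one_sub_of_mem_jacobson {x : R} (hx : x ∈ Ring.jacobson R) : IsUnit (1 - x) := by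
  have key : ∀ y ∈ Ring.jacobson R, ∃ z, z * (1 - y) = 1 := fun y hy => by
    rw [← Ideal.jacobson_bot] at hy
    obtain ⟨z, hz⟩ := Ideal.mem_jacobson_iff.mp hy (-1)
    refine ⟨z, ?_⟩
    have := (Submodule.mem_bot R).mp hz
    rw [← sub_eq_zero, ← this]
    noncomm_ring
  obtain ⟨z, hz⟩ := key x hx
  have h1 : 1 - z = -(z * x) := by rw [← hz]; noncomm_ring
  obtain ⟨w, hw⟩ := key (1 - z) (h1 ▸ neg_mem (Ideal.mul_mem_left _ z hx))
  rw [sub_sub_cancel] at hw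
  have h2 : w = 1 - x := left_inv_eq_right_inv hw hz
  exact ⟨⟨1 - x, z, h2 ▸ hw, hz⟩, rfl⟩

theorem mem_jacobson_iff_mk_eq_zero {x : R} :
    x ∈ Ring.jacobson R ↔ Ideal.Quotient.mk (Ring.jacobson R) x = 0 :=
  Ideal.Quotient.eq_zero_iff_mem.symm

theorem IsIdempotentElem.eq_zero_of_mem_jacobson {e : R} (he : IsIdempotentElem e)
    (h : e ∈ Ring.jacobson R) : e = 0 := by
  refine (isUnit_one_sub_of_mem_jacobson h).mul_right_eq_zero.mp ?_
  rw [sub_mul, one_mul, he.eq, sub_self]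

/-- The left ideal of `b` is generated by an idempotent `p = cb`, and `b = dp` gives `bp = b`. -/
theorem exists_mul_mul_eq_self [IsSemisimpleRing R] (b : R) : ∃ c, b * c * b = b := by
  obtain ⟨p, hp, hb⟩ := IsSemisimpleRing.ideal_eq_span_idempotent (Ideal.span {b})
  obtain ⟨c, hc⟩ := Ideal.mem_span_singleton'.mp (hb ▸ Ideal.mem_span_singleton_self p)
  obtain ⟨d, hd⟩ := Ideal.mem_span_singleton'.mp (hb ▸ Ideal.mem_span_singleton_self b)
  refine ⟨c, ?_⟩
  rw [mul_assoc, hc, ← hd, mul_assoc, hp.eq]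

local notation "π" => Ideal.Quotient.mk (Ring.jacobson R)

/-- A primitive idempotent of a semiperfect ring stays primitive modulo the radical. -/
theorem IsPrimitiveIdempotent.eq_zero_or_eq (hR : IsSemiperfectRing R) {e : R}
    (he : IsPrimitiveIdempotent e) {g : R ⧸ Ring.jacobson R} (hg : IsIdempotentElem g)
    (h₁ : π e * g = g) (h₂ : g * π e = g) : g = 0 ∨ g = π e := by
  obtain ⟨x, hx, rfl⟩ := hR.2 g hg
  have hmem : x * (1 - e) ∈ Ring.jacobson R := by
    rw [mem_jacobson_iff_mk_eq_zero, map_mul, map_sub, map_one, mul_sub, mul_one, h₂, sub_self]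
  obtain ⟨u, hu⟩ := isUnit_one_sub_of_mem_jacobson hmem
  have hπu : π (u : R) = 1 := by
    rw [hu, map_sub, map_one, mem_jacobson_iff_mk_eq_zero.mp hmem, sub_zero]
  have hπv : π (↑u⁻¹ : R) = 1 := by
    simpa only [map_mul, hπu, one_mul, map_one] using congrArg π u.mul_inv
  have hxu : x * u = x * e := by
    rw [hu, mul_sub, ← mul_assoc, hx.eq, mul_one, mul_sub, mul_one, sub_sub_cancel]
  -- As `xu = xe`, `y = e(u⁻¹xu)` with `u⁻¹xu = u⁻¹xe` idempotent; thus `y` is an idempotent of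
  -- `eRe` lifting `g`.
  set y := e * ↑u⁻¹ * x * e with hy
  have hey : e * y = y := by rw [hy]; simp only [← mul_assoc, he.idem.eq]
  have hye : y * e = y := by rw [hy]; simp only [mul_assoc, he.idem.eq]
  have hyy : IsIdempotentElem y := by
    have h3 : y = e * (↑u⁻¹ * (x * u)) := by rw [hxu, hy]; simp only [mul_assoc]
    calc y * y = y * (↑u⁻¹ * (x * u)) := by nth_rewrite 2 [h3]; rw [← mul_assoc, hye]
      _ = e * ↑u⁻¹ * x * (u * ↑u⁻¹) * x * u := by rw [h3]; simp only [mul_assoc]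
      _ = e * ↑u⁻¹ * (x * x) * u := by rw [Units.mul_inv, mul_one]; simp only [mul_assoc]
      _ = y := by rw [hx.eq, h3]; simp only [mul_assoc]
  have hπy : π y = π x := by
    rw [hy, map_mul, map_mul, map_mul, hπv, mul_one, h₁, h₂]
  have hz : IsIdempotentElem (e - y) := by
    change (e - y) * (e - y) = e - y
    rw [sub_mul, mul_sub, mul_sub, he.idem.eq, hey, hye, hyy.eq, sub_self, sub_zero]
  rcases he.indecomposable y (e - y) hyy hz (by rw [mul_sub, hye, hyy.eq, sub_self])
    (by rw [sub_mul, hey, hyy.eq, sub_self]) (add_sub_cancel y e) with h | h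
  · left
    rw [← hπy, h, map_zero]
  · right
    rw [← hπy, ← sub_eq_zero.mp h]

/-- For a quasi-inverse `c` of `b`, both `cb` and `bc` are nonzero idempotents below `e` and `e'`,
so primitivity identifies them. -/
theorem exists_mul_eq_of_corner (hR : IsSemiperfectRing R) {e e' : R}
    (he : IsPrimitiveIdempotent e) (he' : IsPrimitiveIdempotent e') {b : R ⧸ Ring.jacobson R}
    (hb : b ≠ 0) (h₁ : π e' * b = b) (h₂ : b * π e = b) :
    ∃ c, c * b = π e ∧ b * c = π e' := by
  have := hR.1
  obtain ⟨c, hc⟩ := exists_mul_mul_eq_self b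
  have hc' : b * (π e * c * π e') * b = b := by
    rw [← mul_assoc, ← mul_assoc, h₂, mul_assoc _ _ b, h₁, hc]
  have he1 : π e * π e = π e := by rw [← map_mul, he.idem.eq]
  have he2 : π e' * π e' = π e' := by rw [← map_mul, he'.idem.eq]
  refine ⟨π e * c * π e', ?_, ?_⟩
  · refine (he.eq_zero_or_eq hR ?_ ?_ ?_).resolve_left fun h => hb ?_
    · change _ * _ = _
      rw [mul_assoc (π e * c * π e') b, ← mul_assoc b, hc']
    · simp only [← mul_assoc, he1]
    · rw [mul_assoc, h₂]
    · rw [← hc', mul_assoc, h, mul_zero]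
  · refine (he'.eq_zero_or_eq hR ?_ ?_ ?_).resolve_left fun h => hb ?_
    · change _ * _ = _
      rw [← mul_assoc, hc']
    · rw [← mul_assoc, h₁]
    · simp only [mul_assoc, he2]
    · rw [← hc', h, zero_mul]

/-- An element `x` of `eR` outside the radical generates `eR`. -/
theorem IsPrimitiveIdempotent.exists_mul_eq (hR : IsSemiperfectRing R) {e : R}
    (he : IsPrimitiveIdempotent e) {x : R} (hx : e * x = x) (hxJ : x ∉ Ring.jacobson R) :
    ∃ r, x * r = e := by
  have := hR.1
  rw [mem_jacobson_iff_mk_eq_zero] at hxJ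
  obtain ⟨c, hc⟩ := exists_mul_mul_eq_self (π x)
  obtain ⟨c, rfl⟩ := Ideal.Quotient.mk_surjective c
  have hex : π e * π x = π x := by rw [← map_mul, hx]
  have hee : π e * π e = π e := by rw [← map_mul, he.idem.eq]
  have hq : π x * π c * π e = π e := by
    refine (he.eq_zero_or_eq hR ?_ ?_ ?_).resolve_left fun h => hxJ ?_
    · change _ * _ = _
      rw [mul_assoc _ (π e), ← mul_assoc (π e), ← mul_assoc (π e), hex, ← mul_assoc, ← mul_assoc, hc]
    · rw [← mul_assoc, ← mul_assoc, hex]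
    · rw [mul_assoc, hee]
    · rw [← hc]
      nth_rewrite 2 [← hex]
      rw [← mul_assoc, h, zero_mul]
  have hj : e - x * c * e ∈ Ring.jacobson R := by
    rw [mem_jacobson_iff_mk_eq_zero, map_sub, map_mul, map_mul, hq, sub_self]
  obtain ⟨u, hu⟩ := isUnit_one_sub_of_mem_jacobson hj
  refine ⟨c * e * ↑u⁻¹, ?_⟩
  have h : x * c * e = e * u := by
    rw [hu, mul_sub, mul_sub, ← mul_assoc, ← mul_assoc, hx, he.idem.eq, mul_one, sub_sub_cancel]
  rw [← mul_assoc, ← mul_assoc, h, mul_assoc, Units.mul_inv, mul_one]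

theorem mem_rightIdealOf_iff {e x : R} (he : IsIdempotentElem e) :
    x ∈ rightIdealOf e ↔ e * x = x := by
  rw [Submodule.mem_span_singleton]
  constructor
  · rintro ⟨a, rfl⟩
    change e * (e * a.unop) = e * a.unop
    rw [← mul_assoc, he.eq]
  · intro h
    exact ⟨MulOpposite.op x, h⟩

/-- Left multiplication by `b` is invertible modulo the radical, and the errors `e - cb` and `e' -
bc` are absorbed by units. -/
theorem nonempty_equiv_of_mk_corner_ne_zero (hR : IsSemiperfectRing R) {e e' : R}
    (he : IsPrimitiveIdempotent e) (he' : IsPrimitiveIdempotent e') {a : R}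
    (ha : π (e' * a * e) ≠ 0) : Nonempty (rightIdealOf e' ≃ₗ[Rᵐᵒᵖ] rightIdealOf e) := by
  set b := e' * a * e with hb
  have h1 : e' * b = b := by rw [hb]; simp only [← mul_assoc, he'.idem.eq]
  have h2 : b * e = b := by rw [hb]; simp only [mul_assoc, he.idem.eq]
  obtain ⟨c, hcb, hbc⟩ := exists_mul_eq_of_corner hR he he' ha
    (by rw [← map_mul, h1]) (by rw [← map_mul, h2])
  obtain ⟨c, rfl⟩ := Ideal.Quotient.mk_surjective c
  let l : rightIdealOf e →ₗ[Rᵐᵒᵖ] rightIdealOf e' :=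
    { toFun := fun x => ⟨b * x.1, by
        rw [mem_rightIdealOf_iff he'.idem, ← mul_assoc, h1]⟩
      map_add' := fun x y => Subtype.ext (mul_add b x.1 y.1)
      map_smul' := fun r x => Subtype.ext (mul_assoc b x.1 r.unop).symm }
  refine ⟨(LinearEquiv.ofBijective l ⟨?_, ?_⟩).symm⟩
  · have hj : e - c * b ∈ Ring.jacobson R := by
      rw [mem_jacobson_iff_mk_eq_zero, map_sub, map_mul, hcb, sub_self]
    refine (injective_iff_map_eq_zero l).mpr fun x hx => Subtype.ext ?_
    have hx' : b * x.1 = 0 := congrArg Subtype.val hx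
    refine (isUnit_one_sub_of_mem_jacobson hj).mul_right_eq_zero.mp ?_
    rw [sub_mul, sub_mul, one_mul, (mem_rightIdealOf_iff he.idem).mp x.2, mul_assoc, hx', mul_zero,
      sub_zero, sub_self]
  · have hj : e' - b * c ∈ Ring.jacobson R := by
      rw [mem_jacobson_iff_mk_eq_zero, map_sub, map_mul, hbc, sub_self]
    obtain ⟨u, hu⟩ := isUnit_one_sub_of_mem_jacobson hj
    have h : b * c = e' * u := by
      rw [hu, mul_sub, mul_sub, ← mul_assoc, h1, he'.idem.eq, mul_one, sub_sub_cancel]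
    intro y
    refine ⟨⟨e * (c * ↑u⁻¹ * y.1), ?_⟩, Subtype.ext ?_⟩
    · rw [mem_rightIdealOf_iff he.idem, ← mul_assoc, he.idem.eq]
    · change b * (e * (c * ↑u⁻¹ * y.1)) = y.1
      rw [← mul_assoc, h2, ← mul_assoc, ← mul_assoc, h, mul_assoc e', Units.mul_inv, mul_one,
        (mem_rightIdealOf_iff he'.idem).mp y.2]

/-- Idempotents of a basic semiperfect ring are central modulo the radical. -/
theorem IsBasicRing.commute_mk (hR : IsSemiperfectRing R) (hb : IsBasicRing R)
    {p : R ⧸ Ring.jacobson R} (hp : IsIdempotentElem p) (b : R ⧸ Ring.jacobson R) :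
    p * b = b * p := by
  obtain ⟨n, e, hc, hprim, hne⟩ := hb
  have hoff : ∀ i j, i ≠ j → ∀ b, π (e i) * b * π (e j) = 0 := fun i j hij b => by
    obtain ⟨b, rfl⟩ := Ideal.Quotient.mk_surjective b
    by_contra h
    rw [← map_mul, ← map_mul] at h
    obtain ⟨l⟩ := nonempty_equiv_of_mk_corner_ne_zero hR (hprim j) (hprim i) h
    exact (hne i j hij).false l
  have hsum : ∑ i, π (e i) = 1 := by rw [← map_sum, hc.complete, map_one]
  have hcomm : ∀ i b, π (e i) * b = b * π (e i) := fun i b => by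
    have h1 : π (e i) * b = π (e i) * b * π (e i) := by
      nth_rewrite 1 [← mul_one (π (e i) * b), ← hsum, Finset.mul_sum]
      exact Finset.sum_eq_single i (fun j _ hj => hoff i j hj.symm b) (by simp)
    have h2 : b * π (e i) = π (e i) * b * π (e i) := by
      nth_rewrite 1 [← one_mul (b * π (e i)), ← hsum, Finset.sum_mul]
      rw [Finset.sum_eq_single i (fun j _ hj => by rw [← mul_assoc]; exact hoff j i hj b) (by simp),
        mul_assoc]
    rw [h1, ← h2]
  -- Each `e i * p` is an idempotent below the primitive `e i`, hence `0` or `e i` modulo the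
  -- radical, and so central.
  have hpi : ∀ i, π (e i) * p * b = b * (π (e i) * p) := fun i => by
    have hee : π (e i) * π (e i) = π (e i) := by rw [← map_mul, (hprim i).idem.eq]
    have hidem : IsIdempotentElem (π (e i) * p) := by
      change _ * _ = _
      rw [mul_assoc, ← mul_assoc p, ← hcomm i p, mul_assoc _ p p, hp.eq, ← mul_assoc, hee]
    rcases (hprim i).eq_zero_or_eq hR hidem (by rw [← mul_assoc, hee])
      (by rw [mul_assoc, ← hcomm, ← mul_assoc, hee]) with h | h
    · rw [h, zero_mul, mul_zero]
    · rw [h, hcomm]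
  rw [← one_mul p, ← hsum, Finset.sum_mul, Finset.sum_mul, Finset.mul_sum]
  exact Finset.sum_congr rfl fun i _ => hpi i

theorem IsBasicRing.mul_one_sub_mem_jacobson (hR : IsSemiperfectRing R) (hb : IsBasicRing R)
    {e x : R} (he : IsIdempotentElem e) (hx : e * x = x) : x * (1 - e) ∈ Ring.jacobson R := by
  rw [mem_jacobson_iff_mk_eq_zero, ← hx, map_mul, map_mul,
    hb.commute_mk hR (show π e * π e = π e by rw [← map_mul, he.eq]), mul_assoc, ← map_mul, mul_sub,
    mul_one, he.eq, sub_self, map_zero, mul_zero]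

end Semiperfect

/-! ### Generation of the radical when the top has no self-extensions. -/

section Nakayama

variable {A : Type u} [Ring A] {M : Type u} [AddCommGroup M] [Module A M]

/-- If `M` has simple top `S` with `Ext^1(S, S) = 0`, then `rad M ≤ U` as soon as `M` maps onto
every simple quotient of `rad M` which is killed on `U`. -/
theorem jacobson_le_of_extVanish [IsNoetherianRing A] [Module.Finite A M]
    (hco : IsCoatom (Module.jacobson A M))
    (hext : ExtVanish A (M ⧸ Module.jacobson A M) (M ⧸ Module.jacobson A M) 1) (U : Submodule A M)
    (hU : ∀ (T : Type u) [AddCommGroup T] [Module A T] [IsSimpleModule A T]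
      (q : Module.jacobson A M →ₗ[A] T), Function.Surjective q → (∀ x, x.1 ∈ U → q x = 0) →
      ∃ h : M →ₗ[A] T, h ≠ 0) :
    Module.jacobson A M ≤ U := by
  set rad := Module.jacobson A M
  by_contra hle
  have hU' : U.comap rad.subtype ≠ ⊤ := fun h => hle ((Submodule.comap_subtype_eq_top).mp h)
  obtain ⟨K, hK, hUK⟩ := (eq_top_or_exists_le_coatom _).resolve_left hU'
  have hT : IsSimpleModule A (rad ⧸ K) := isSimpleModule_iff_isCoatom.mpr hK
  obtain ⟨h, hne⟩ := hU (rad ⧸ K) K.mkQ K.mkQ_surjective fun x hx =>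
    (Submodule.Quotient.mk_eq_zero K).mpr (hUK hx)
  have hsurj := LinearMap.surjective_of_ne_zero hne
  have hker : rad = LinearMap.ker h := by
    have hle : rad ≤ LinearMap.ker h := sInf_le (LinearMap.isCoatom_ker_of_surjective hsurj)
    refine (eq_or_lt_of_le hle).resolve_right fun hlt => hne ?_
    exact LinearMap.ker_eq_top.mp (hco.2 _ hlt)
  -- The simple quotient `rad/K` is isomorphic to the top, so `Ext¹ = 0` extends `rad → rad/K` to
  -- `M`; but every map from `M` to its top kills `rad`.
  let θ : (rad ⧸ K) ≃ₗ[A] M ⧸ rad := ((Submodule.quotEquivOfEq _ _ hker).trans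
    (LinearMap.quotKerEquivOfSurjective _ hsurj)).symm
  obtain ⟨l, hl⟩ := hext.exists_extension rad.subtype_injective (LinearMap.exact_subtype_mkQ rad)
    rad.mkQ_surjective (θ.toLinearMap ∘ₗ K.mkQ)
  have hnt := IsSimpleModule.nontrivial A (rad ⧸ K)
  obtain ⟨t, ht⟩ := exists_ne (0 : rad ⧸ K)
  refine ht (θ.injective ?_)
  obtain ⟨x, rfl⟩ := K.mkQ_surjective t
  have h1 := LinearMap.congr_fun hl x
  have h2 : l x.1 ∈ Module.jacobson A (M ⧸ rad) := Module.le_comap_jacobson l x.2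
  rw [Module.jacobson_quotient_jacobson, Submodule.mem_bot] at h2
  rw [map_zero, ← h2]
  exact h1.symm

end Nakayama

/-! ### The module `eR`, its radical and its top. -/

section Top

variable {R : Type u} [Ring R] {e : R}

/-- The idempotent `e` as an element of `eR`. -/
def idemGen (e : R) : rightIdealOf e := ⟨e, Submodule.mem_span_singleton_self e⟩

theorem op_smul_idemGen (he : IsIdempotentElem e) (x : rightIdealOf e) :
    MulOpposite.op x.1 • idemGen e = x :=
  Subtype.ext ((mem_rightIdealOf_iff he).mp x.2)

theorem projective_rightIdealOf (he : IsIdempotentElem e) :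
    Module.Projective Rᵐᵒᵖ (rightIdealOf e) :=
  Module.Projective.of_split
    { toFun := fun x : rightIdealOf e => MulOpposite.op x.1
      map_add' := fun _ _ => rfl
      map_smul' := fun _ _ => rfl }
    (LinearMap.toSpanSingleton Rᵐᵒᵖ _ (idemGen e))
    (LinearMap.ext fun x => op_smul_idemGen he x)

/-- `eJ = eR ∩ J` as a submodule of `eR`. -/
def rightIdealRadical (e : R) : Submodule Rᵐᵒᵖ (rightIdealOf e) where
  carrier := {x | x.1 ∈ Ring.jacobson R}
  add_mem' {a b} ha hb := (Ring.jacobson R).add_mem (a := a.1) (b := b.1) ha hb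
  zero_mem' := zero_mem (Ring.jacobson R)
  smul_mem' a x hx := (Ring.jacobson R).mul_mem_right (a := x.1) a.unop hx

theorem eq_top_of_idemGen_mem (he : IsIdempotentElem e) {L : Submodule Rᵐᵒᵖ (rightIdealOf e)}
    (h : idemGen e ∈ L) : L = ⊤ :=
  eq_top_iff.mpr fun x _ => op_smul_idemGen he x ▸ L.smul_mem _ h

theorem isCoatom_rightIdealRadical (hR : IsSemiperfectRing R) (he : IsPrimitiveIdempotent e) :
    IsCoatom (rightIdealRadical e) := by
  constructor
  · intro h
    exact he.ne_zero (he.idem.eq_zero_of_mem_jacobson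
      (show idemGen e ∈ rightIdealRadical e from h ▸ Submodule.mem_top))
  · intro L hL
    obtain ⟨x, hxL, hx⟩ := SetLike.exists_of_lt hL
    obtain ⟨r, hr⟩ := he.exists_mul_eq hR ((mem_rightIdealOf_iff he.idem).mp x.2) hx
    refine eq_top_of_idemGen_mem he.idem ?_
    rw [show idemGen e = MulOpposite.op r • x from Subtype.ext hr.symm]
    exact L.smul_mem _ hxL

/-- `eJ` is itself maximal. Conversely, if a maximal `L` missed `x ∈ eJ`, then `e = y + xa` with `y
∈ L`, so `y = e(1 - xa)` with `1 - xa` a unit, forcing `e ∈ L`. -/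
theorem jacobson_rightIdealOf (hR : IsSemiperfectRing R) (he : IsPrimitiveIdempotent e) :
    Module.jacobson Rᵐᵒᵖ (rightIdealOf e) = rightIdealRadical e := by
  refine le_antisymm (sInf_le (isCoatom_rightIdealRadical hR he)) (le_sInf fun L hL x hx => ?_)
  by_contra hxL
  have hlt : L < L ⊔ Submodule.span Rᵐᵒᵖ {x} :=
    left_lt_sup.mpr fun h => hxL (h (Submodule.mem_span_singleton_self x))
  have hmem : idemGen e ∈ L ⊔ Submodule.span Rᵐᵒᵖ {x} := hL.2 _ hlt ▸ Submodule.mem_top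
  obtain ⟨y, hy, z, hz, hyz⟩ := Submodule.mem_sup.mp hmem
  obtain ⟨a, rfl⟩ := Submodule.mem_span_singleton.mp hz
  have hyz' : y.1 + x.1 * a.unop = e := congrArg Subtype.val hyz
  obtain ⟨u, hu⟩ := isUnit_one_sub_of_mem_jacobson (Ideal.mul_mem_right a.unop _ hx)
  have hyu : y.1 = e * u := by
    rw [hu, mul_sub, mul_one, ← mul_assoc, (mem_rightIdealOf_iff he.idem).mp x.2]
    exact eq_sub_of_add_eq hyz'
  refine hL.1 (eq_top_of_idemGen_mem he.idem ?_)
  rw [show idemGen e = MulOpposite.op (↑u⁻¹ : R) • y from Subtype.ext ?_]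
  · exact L.smul_mem _ hy
  · change e = y.1 * ↑u⁻¹
    rw [hyu, mul_assoc, Units.mul_inv, mul_one]

theorem isCoatom_jacobson_rightIdealOf (hR : IsSemiperfectRing R) (he : IsPrimitiveIdempotent e) :
    IsCoatom (Module.jacobson Rᵐᵒᵖ (rightIdealOf e)) :=
  jacobson_rightIdealOf hR he ▸ isCoatom_rightIdealRadical hR he

theorem isSimpleModule_topOf (hR : IsSemiperfectRing R) (he : IsPrimitiveIdempotent e) :
    IsSimpleModule Rᵐᵒᵖ (topOf e) :=
  isSimpleModule_iff_isCoatom.mpr (isCoatom_jacobson_rightIdealOf hR he)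

/-- Basicness enters here: `e` is central modulo the radical, so `eR(1 - e) ⊆ J`. -/
theorem op_one_sub_smul_topOf (hR : IsSemiperfectRing R) (hb : IsBasicRing R)
    (he : IsPrimitiveIdempotent e) (s : topOf e) : MulOpposite.op (1 - e) • s = 0 := by
  obtain ⟨x, rfl⟩ := (Module.jacobson Rᵐᵒᵖ (rightIdealOf e)).mkQ_surjective s
  rw [← map_smul]
  refine (Submodule.Quotient.mk_eq_zero _).mpr ?_
  rw [jacobson_rightIdealOf hR he]
  exact hb.mul_one_sub_mem_jacobson hR he.idem ((mem_rightIdealOf_iff he.idem).mp x.2)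

variable {W : Type u} [AddCommGroup W] [Module Rᵐᵒᵖ W]

variable (e) in
/-- The map `eR → W` given by multiplication with an element of `W`. -/
def rightIdealHom (w : W) : rightIdealOf e →ₗ[Rᵐᵒᵖ] W where
  toFun x := MulOpposite.op x.1 • w
  map_add' x y := by
    change MulOpposite.op (x.1 + y.1) • w = _
    rw [MulOpposite.op_add, add_smul]
  map_smul' a x := by
    change MulOpposite.op (x.1 * a.unop) • w = a • MulOpposite.op x.1 • w
    rw [MulOpposite.op_mul, mul_smul, MulOpposite.op_unop]

theorem rightIdealHom_idemGen (hW : ∀ w : W, MulOpposite.op (1 - e) • w = 0) (w : W) :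
    rightIdealHom e w (idemGen e) = w := by
  have h := hW w
  rw [MulOpposite.op_sub, sub_smul, MulOpposite.op_one, one_smul, sub_eq_zero] at h
  exact h.symm

/-- The submodule of `eR` generated by `eR(1 - e)`. -/
abbrev rightIdealTrace (e : R) : Submodule Rᵐᵒᵖ (rightIdealOf e) :=
  Submodule.span Rᵐᵒᵖ {x | x.1 * (1 - e) = x.1}

/-- If `Ext^1(S, S) = 0` then `eJ` is generated by `eR(1 - e)`. -/
theorem jacobson_le_rightIdealTrace (hnr : IsNoetherianRing Rᵐᵒᵖ) (hR : IsSemiperfectRing R)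
    (he : IsPrimitiveIdempotent e) (hext : ExtVanish Rᵐᵒᵖ (topOf e) (topOf e) 1) :
    Module.jacobson Rᵐᵒᵖ (rightIdealOf e) ≤ rightIdealTrace e := by
  have hfin : Module.Finite Rᵐᵒᵖ (rightIdealOf e) :=
    Module.Finite.iff_fg.mpr (Submodule.fg_span_singleton e)
  refine jacobson_le_of_extVanish (isCoatom_jacobson_rightIdealOf hR he) hext _
    fun T _ _ _ q hq hqU => ?_
  -- `T(1 - e)` is the image of `rad(eR)(1 - e)`, on which `q` vanishes; hence `te = t`, and `e ↦ t`
  -- defines a nonzero map `eR → T`.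
  have hT0 : ∀ t : T, MulOpposite.op (1 - e) • t = 0 := fun t => by
    obtain ⟨x, rfl⟩ := hq t
    rw [← map_smul]
    refine hqU _ (Submodule.subset_span ?_)
    change x.1.1 * (1 - e) * (1 - e) = x.1.1 * (1 - e)
    rw [mul_assoc, he.idem.one_sub.eq]
  have hnt := IsSimpleModule.nontrivial Rᵐᵒᵖ T
  obtain ⟨t, ht⟩ := exists_ne (0 : T)
  refine ⟨rightIdealHom e t, fun h => ht ?_⟩
  rw [← rightIdealHom_idemGen hT0 t, h, LinearMap.zero_apply]

/-- `S` embeds into each nonzero module `W` with `W(1 - e) = 0`. -/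
theorem exists_injective_of_topOf (hnr : IsNoetherianRing Rᵐᵒᵖ) (hR : IsSemiperfectRing R)
    (he : IsPrimitiveIdempotent e) (hext : ExtVanish Rᵐᵒᵖ (topOf e) (topOf e) 1)
    [Nontrivial W] (hW : ∀ w : W, MulOpposite.op (1 - e) • w = 0) :
    ∃ g : topOf e →ₗ[Rᵐᵒᵖ] W, Function.Injective g := by
  have := isSimpleModule_topOf hR he
  obtain ⟨w, hw⟩ := exists_ne (0 : W)
  have hle : Module.jacobson Rᵐᵒᵖ (rightIdealOf e) ≤ LinearMap.ker (rightIdealHom e w) := by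
    refine (jacobson_le_rightIdealTrace hnr hR he hext).trans (Submodule.span_le.mpr fun x hx => ?_)
    change MulOpposite.op x.1 • w = 0
    rw [← show x.1 * (1 - e) = x.1 from hx, MulOpposite.op_mul, mul_smul, hW]
  refine ⟨Submodule.liftQ _ _ hle, LinearMap.injective_of_ne_zero fun h => hw ?_⟩
  rw [← rightIdealHom_idemGen hW w, ← Submodule.liftQ_apply _ _ (h := hle), h,
    LinearMap.zero_apply]

end Top

/-! ### Identification of `eR(1 - e)` with `φ(eR)`, and the conclusion. -/

section Corner

variable {R : Type u} [Ring R] {f : R}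

/-- The inclusion `fRf → R`, between opposite rings. -/
def cornerInclusion (hf : IsIdempotentElem f) : (hf.Corner)ᵐᵒᵖ →ₙ+* Rᵐᵒᵖ where
  toFun c := MulOpposite.op c.unop.1
  map_mul' _ _ := rfl
  map_zero' := rfl
  map_add' _ _ := rfl

theorem cornerInclusion_injective (hf : IsIdempotentElem f) :
    Function.Injective (cornerInclusion hf) := fun _ _ h =>
  MulOpposite.unop_injective (Subtype.ext (MulOpposite.op_injective h))

theorem exists_cornerInclusion_eq (hf : IsIdempotentElem f) (a : Rᵐᵒᵖ) :
    ∃ c, cornerInclusion hf c = cornerInclusion hf 1 * a * cornerInclusion hf 1 :=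
  ⟨MulOpposite.op ⟨f * a.unop * f, a.unop, rfl⟩, MulOpposite.unop_injective (mul_assoc _ _ _)⟩

/-- `eRf` is the part of `eR` fixed by `f`. -/
def peirceCornerEquiv {e : R} (he : IsIdempotentElem e) (hf : IsIdempotentElem f) :
    peirceCorner e f ≃ₗ[(hf.Corner)ᵐᵒᵖ] cornerPart (cornerInclusion hf) (rightIdealOf e) where
  toFun x := ⟨⟨x.1, by
    obtain ⟨x, a, rfl⟩ := x
    rw [mem_rightIdealOf_iff he]
    simp only [← mul_assoc, he.eq]⟩, by
    obtain ⟨x, a, rfl⟩ := x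
    refine Subtype.ext ?_
    change e * a * f * f = e * a * f
    rw [mul_assoc, hf.eq]⟩
  map_add' _ _ := rfl
  map_smul' _ _ := rfl
  invFun x := ⟨x.1.1, x.1.1, by
    rw [(mem_rightIdealOf_iff he).mp x.1.2]
    exact congrArg Subtype.val x.2⟩
  left_inv _ := rfl
  right_inv _ := rfl

end Corner

theorem mainTheorem5 {R : Type u} [Ring R]
    (hnl : IsNoetherianRing R) (hnr : IsNoetherianRing Rᵐᵒᵖ)
    (hsp : IsSemiperfectRing R) (hb : IsBasicRing R)
    (e : R) (he : IsPrimitiveIdempotent e)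
    (hext : Subsingleton (Abelian.Ext (topOf e) (topOf e) 1))
    (hpd : projectiveDimension (topOf e) ≠ ⊤)
    (hpdΓ : projectiveDimension
      (ModuleCat.of (he.idem.one_sub.Corner)ᵐᵒᵖ (peirceCorner e (1 - e))) ≠ ⊤) :
    IsSelfOrthogonal (topOf e) := by
  obtain ⟨d, hd⟩ := (projectiveDimension_ne_top_iff _).mp hpd
  obtain ⟨d', hd'⟩ := (projectiveDimension_ne_top_iff _).mp hpdΓ
  have hlarge : ∀ k, d + 1 ≤ k → ExtVanish Rᵐᵒᵖ (topOf e) (topOf e) k := fun k hk =>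
    HasProjectiveDimensionLT.subsingleton (topOf e) (d + 1) k hk _
  have := isSimpleModule_topOf hsp he
  have := IsSimpleModule.nontrivial Rᵐᵒᵖ (topOf e)
  have := projective_rightIdealOf he.idem
  have hfin : Module.Finite Rᵐᵒᵖ (rightIdealOf e) :=
    Module.Finite.iff_fg.mpr (Submodule.fg_span_singleton e)
  have hemb : EmbedsInKilled (cornerInclusion he.idem.one_sub) (topOf e) := fun W _ _ _ hW =>
    exists_injective_of_topOf hnr hsp he hext hW
  have hdC := hasProjectiveDimensionLT_of_iso
    (peirceCornerEquiv he.idem he.idem.one_sub).toModuleIso (d' + 1)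
  have hstep : ∀ n, (∀ k, n + 1 < k → ExtVanish Rᵐᵒᵖ (topOf e) (topOf e) k) →
      ExtVanish Rᵐᵒᵖ (topOf e) (topOf e) (n + 1) := fun n hn => by
    by_contra hn1
    have h0 := ExtVanish.of_projectiveDimension_cornerPart
      (cornerInclusion_injective he.idem.one_sub) (exists_cornerInclusion_eq he.idem.one_sub)
      (op_one_sub_smul_topOf hsp hb he) hemb hn1 hn d' (rightIdealOf e) hdC
      (fun k hk => by
        obtain ⟨j, rfl⟩ := Nat.exists_eq_add_of_le' (Nat.one_le_of_lt hk)
        exact ExtVanish.of_projective j) 0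
    have h1 := extVanish_zero_iff.mp h0 (Module.jacobson Rᵐᵒᵖ (rightIdealOf e)).mkQ
    obtain ⟨s, hs⟩ := exists_ne (0 : topOf e)
    obtain ⟨x, rfl⟩ := (Module.jacobson Rᵐᵒᵖ (rightIdealOf e)).mkQ_surjective s
    exact hs (LinearMap.congr_fun h1 x)
  -- Descending induction on the degree: `m` bounds the distance from `n` up to `d`, beyond which
  -- all Ext groups vanish.
  have hall : ∀ m n, d ≤ n + m → ∀ k, n + 1 ≤ k → ExtVanish Rᵐᵒᵖ (topOf e) (topOf e) k := by
    intro m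
    induction m with
    | zero => exact fun n hn k hk => hlarge k (by lia)
    | succ m ih =>
      intro n hn k hk
      have h := ih (n + 1) (by lia)
      rcases Nat.eq_or_lt_of_le hk with rfl | hlt
      · exact hstep n fun k hk => h k hk
      · exact h k hlt
  exact fun k hk => hall d 0 (by lia) k hk
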